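/- An increasing tableau in $\mathrm{Inc}^q(r\times c)$ is a filling of the $r\times c$ rectangle with elements of $[q]=\{1,\dots,q\}$ whose rows strictly increase from left to right and whose columns strictly increase from top to bottom; it is packed, and belongs to $\mathrm{PackInc}^q(r\times c)$, if every element of $[q]$ appears in it. Let $\mathcal A=(a_1<\dots<a_n)$ be a finite alphabet. The $K$-gromotion of an increasing tableau on the alphabet $\mathcal A$ is obtained as follows. Replace every entry $a_1$ by the symbol $\bullet$. Then, for $j=2,\dots,n$ in this order, let $\mathfrak B$ be the set of boxes containing $\bullet$, let $\mathfrak C$ be the set of boxes with entry $a_j$ that are adjacent to (share an edge with) a box of $\mathfrak B$, and simultaneously fill all boxes of $\mathfrak C$ with $\bullet$ and all boxes of $\mathfrak B$ adjacent to a box of $\mathfrak C$ with $a_j$. Finally replace every $\bullet$ by $a_1$. The result is an increasing tableau on the alphabet $(a_2<\dots<a_n<a_1)$. We say that $a_j$ moves from row $i+1$ to row $i$ if in step $j$ some box of $\mathfrak B$ in row $i$ has the box immediately below it in $\mathfrak C$. For $T\in\mathrm{Inc}^q(r\times c)$ (on the alphabet $1<2<\dots<q$) and $1\le i<r$, the promotion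 digraph $\mathsf{prom}_i(T)$ has vertex set $[q]$, and an arrow $\alpha\to\beta$ whenever $\beta$ moves from row $i+1$ to row $i$ in the application of $K$-gromotion to the $(\alpha-1)$-st iterate of $K$-gromotion on $T$. Theorem. (a) If $T\in\mathrm{PackInc}^q(3\times c)$, then for each $i\in\{1,2\}$ every vertex $v\in[q]$ has indegree at least $1$ in $\mathsf{prom}_i(T)$. (b) In contrast, this fails for four rows: there exist $c$, $q$, a tableau $T\in\mathrm{PackInc}^q(4\times c)$, an index $i\in\{1,2,3\}$ and a vertex $v\in[q]$ whose indegree in $\mathsf{prom}_i(T)$ is $0$. -/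

import Mathlib

namespace KPromotion

/-- A box of the `r × c` rectangle: row first, then column, both counted from `0`. -/
abbrev Box (r c : ℕ) : Type := Fin r × Fin c

/-- A filling of the `r × c` rectangle by natural numbers. -/
abbrev Filling (r c : ℕ) : Type := Box r c → ℕ

/-- A filling in which some boxes may hold the symbol `•` (that is, `none`). -/
abbrev BulletFilling (r c : ℕ) : Type := Box r c → Option ℕ

/-- The increasing tableaux `Inc^q(r × c)`: the entries lie in `{1, …, q}`, rows strictly increase
from left to right and columns strictly increase from top to bottom. -/
structure IsIncreasing {r c : ℕ} (q : ℕ) (T : Filling r c) : Prop where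
  mem_alphabet : ∀ b, T b ∈ Set.Icc 1 q
  row_strictMono : ∀ x : Fin r, StrictMono fun y : Fin c => T (x, y)
  col_strictMono : ∀ y : Fin c, StrictMono fun x : Fin r => T (x, y)

/-- The packed increasing tableaux `PackInc^q(r × c)`: every value of `{1, …, q}` is an entry. -/
structure IsPackedIncreasing {r c : ℕ} (q : ℕ) (T : Filling r c) : Prop
    extends IsIncreasing q T where
  packed : ∀ v ∈ Set.Icc 1 q, ∃ b, T b = v

/-- `Below b b'`: the box `b'` is immediately below `b`. -/
abbrev Below {r c : ℕ} (b b' : Box r c) : Prop :=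
  b'.1.val = b.1.val + 1 ∧ b'.2 = b.2

/-- `RightOf b b'`: the box `b'` is immediately to the right of `b`. -/
abbrev RightOf {r c : ℕ} (b b' : Box r c) : Prop :=
  b'.1 = b.1 ∧ b'.2.val = b.2.val + 1

/-- Two boxes are adjacent if they share an edge. -/
abbrev Adjacent {r c : ℕ} (b b' : Box r c) : Prop :=
  Below b b' ∨ Below b' b ∨ RightOf b b' ∨ RightOf b' b

/-- Delete all entries `a`, writing `•` instead. -/
def delete {r c : ℕ} (a : ℕ) (T : Filling r c) : BulletFilling r c :=
  fun b => if T b = a then none else some (T b)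

/-- `b` belongs to the set `𝔅` of boxes that hold `•`. -/
abbrev InB {r c : ℕ} (S : BulletFilling r c) (b : Box r c) : Prop :=
  S b = none

/-- `b` belongs to the set `ℭ` of boxes that hold `β` and are adjacent to a box in `𝔅`. -/
abbrev InC {r c : ℕ} (β : ℕ) (S : BulletFilling r c) (b : Box r c) : Prop :=
  S b = some β ∧ ∃ b', Adjacent b b' ∧ InB S b'

/-- One sliding step for the letter `β`: all boxes of `ℭ` are filled with `•`, and all boxes of `𝔅`
adjacent to a box of `ℭ` are filled with `β`. -/
def slide {r c : ℕ} (S : BulletFilling r c) (β : ℕ) : BulletFilling r c :=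
  fun b =>
    if InC β S b then none
    else if InB S b ∧ ∃ b', Adjacent b b' ∧ InC β S b' then some β
    else S b

/-- `K`-gromotion of a filling on the finite alphabet `A`, which is given as the list of its letters
in increasing order: delete the least letter `a`, slide for the other letters in increasing order,
and replace every `•` by `a`. -/
def gromotion {r c : ℕ} (A : List ℕ) (T : Filling r c) : Filling r c :=
  match A with
  | [] => T
  | a :: rest => fun b => (rest.foldl slide (delete a T) b).getD a

/-- The alphabet `(a₂ < ⋯ < aₙ < a₁)` obtained from `A = (a₁ < ⋯ < aₙ)`. -/
def grow (A : List ℕ) : List ℕ := A.rotate 1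

/-- `gromotionIter k A T` is the pair of the `k`-th iterate of gromotion on `T`, where `T` is a
filling on the alphabet `A`, and the alphabet of that iterate. -/
def gromotionIter {r c : ℕ} (k : ℕ) (A : List ℕ) (T : Filling r c) : List ℕ × Filling r c :=
  (fun p : List ℕ × Filling r c => (grow p.1, gromotion p.1 p.2))^[k] (A, T)

/-- `β` moves from row `i + 1` to row `i` (rows counted from `1`) during the gromotion of the
filling `T` on the alphabet `A`: in the sliding step for `β`, performed after those for the letters
in `pre`, some `b ∈ 𝔅` in row `i` has the box `b'` immediately below it in `ℭ`, so that `b` gets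
filled with `β` and `b'` with `•`. -/
def MovesUp {r c : ℕ} (A : List ℕ) (T : Filling r c) (i β : ℕ) : Prop :=
  ∃ (a : ℕ) (pre post : List ℕ), A = a :: (pre ++ β :: post) ∧
    ∃ b b' : Box r c, b.1.val + 1 = i ∧ Below b b' ∧
      InB (pre.foldl slide (delete a T)) b ∧ InC β (pre.foldl slide (delete a T)) b'

/-- The alphabet `1 < 2 < ⋯ < q`. -/
def stdAlphabet (q : ℕ) : List ℕ := List.range' 1 q

/-- The `i`-th promotion digraph `prom_i(T)` of `T ∈ Inc^q(r × c)`, with vertex set `{1, …, q}`: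
there is an arrow `α → β` if `β` moves from row `i + 1` to row `i` in the application of gromotion
to the `(α - 1)`-st iterate of gromotion on `T`. -/
def prom {r c : ℕ} (q : ℕ) (T : Filling r c) (i : ℕ) : Digraph (Set.Icc 1 q) where
  Adj α β :=
    MovesUp (gromotionIter (α.val - 1) (stdAlphabet q) T).1
      (gromotionIter (α.val - 1) (stdAlphabet q) T).2 i β.val

/-- The indegree of a vertex: the number of vertices with an arrow to it. -/
noncomputable def indegree {V : Type*} (G : Digraph V) (v : V) : ℕ :=
  {u | G.Adj u v}.ncard

end KPromotion

namespace KPromotion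

/-! ### Growth of shapes and longest increasing chains -/

/-! Suppose `v` never moves from row `i + 1` to row `i` during the `q` gromotions. After `v - 1` of
them `v` is the least letter, hence lies only in the first row. A copy of `v` strictly below row `i`
of `T` would have left a copy below row `i` up to that moment, so `v` occurs in `T` only in the
first `i` rows (`row_lt_of_not_movesUp`). One step later `v` is the greatest letter, hence lies only
in the last row, and it cannot enter the first `i` rows afterwards. So in the `q`-th iterate it lies
strictly below row `i` (`le_row_of_not_movesUp`).

The two statements conflict because the first and last rows of `T` reappear in the `q`-th iterate
(`gromotionIter_frame`). With three rows, one side of the cut is a single outer row, whether `i` is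
1 or 2. With four rows and `i = 2`, `v` can pass between the two middle rows, and an explicit
tableau does this.

For the outer rows, the shapes `lam q T i k` form a `K`-theoretic growth diagram. The length of a
longest strictly increasing subsequence of the row reading word, read from the bottom row to the
top, is preserved across each strip of the diagram (`Chain.strip`). In a straight shape it is the
length of the first row; in a rectangle minus an inner shape it is the number of columns minus the
length of the last inner row. Thus opposite corners of a rectangle in the diagram determine each
other's outer rows (`growth_rectangle`), and two such reflections lead from `T` to its `q`-th
iterate (`lam_frame`). -/

/-- The shape `k` is obtained from the shape `l` by adding boxes, no two of which are comparable. -/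
structure RookStrip (l k : ℕ → ℕ → Prop) : Prop where
  le : ∀ {x y}, l x y → k x y
  down : ∀ {x y}, k (x + 1) y → l x y
  right : ∀ {x y}, k x (y + 1) → l x y

/-- The local rule of `K`-theoretic growth diagrams. It is symmetric in `k` and `m`. -/
structure Square (l k m n : ℕ → ℕ → Prop) : Prop where
  lk : RookStrip l k
  lm : RookStrip l m
  kn : RookStrip k n
  mn : RookStrip m n
  -- Here `k` minus `l` is the set of bullets and `n` minus `k` the set of boxes of the sliding
  -- letter. A bullet that is filled takes its letter from the right or from below (`meet`); a
  -- letter that leaves its box does so for a bullet on its left or above it (`join`).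
  meet : ∀ {x y}, k x y → m x y → l x y ∨ n x (y + 1) ∨ n (x + 1) y
  join : ∀ {x y}, n x y → k x y ∨ m x y ∨
    (∃ y', y = y' + 1 ∧ ¬ l x y') ∨ (∃ x', x = x' + 1 ∧ ¬ l x' y)

theorem Square.symm {l k m n : ℕ → ℕ → Prop} (h : Square l k m n) : Square l m k n where
  lk := h.lm
  lm := h.lk
  kn := h.mn
  mn := h.kn
  meet h1 h2 := h.meet h2 h1
  join h1 := by
    rcases h.join h1 with h | h | h | h
    exacts [Or.inr (Or.inl h), Or.inl h, Or.inr (Or.inr (Or.inl h)), Or.inr (Or.inr (Or.inr h))]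

theorem RookStrip.ideal {l k : ℕ → ℕ → Prop} (h : RookStrip l k) {x x' y y' : ℕ}
    (hl : l x y) (hx : x' ≤ x) (hy : y' ≤ y) : l x' y' := by
  induction hx with
  | refl =>
    induction hy with
    | refl => exact hl
    | step _ ih => exact ih (h.right (h.le hl))
  | step _ ih => exact ih (h.down (h.le hl))

/-- Squares that do not change in one direction. -/
theorem Square.const {l k : ℕ → ℕ → Prop} (h : RookStrip l k)
    (hk : ∀ {x x' y y'}, k x y → x' ≤ x → y' ≤ y → k x' y') : Square l k l k where
  lk := h
  lm := ⟨id, fun hl => h.ideal hl (Nat.le_succ _) le_rfl, fun hl => h.ideal hl le_rfl (Nat.le_succ _)⟩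
  kn := ⟨id, fun hl => hk hl (Nat.le_succ _) le_rfl, fun hl => hk hl le_rfl (Nat.le_succ _)⟩
  mn := h
  meet _ h2 := Or.inl h2
  join h1 := Or.inl h1

/-- `Chain L t x y n`: the skew increasing tableau encoded by the shapes `L 0 ⊆ L 1 ⊆ ⋯` has
`n` boxes in rows `≥ x` and columns `< y` with letters at most `t`, such that columns and letters
strictly increase and rows weakly decrease. -/
inductive Chain (L : ℕ → ℕ → ℕ → Prop) : ℕ → ℕ → ℕ → ℕ → Prop
  | nil (t x y : ℕ) : Chain L t x y 0
  | skip {t x y n : ℕ} : Chain L t x y n → Chain L (t + 1) x y n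
  | cons {t x y n p s : ℕ} : L (t + 1) p s → ¬ L t p s → x ≤ p → s < y → Chain L t p s n →
      Chain L (t + 1) x y (n + 1)

namespace Chain

variable {L K : ℕ → ℕ → ℕ → Prop}

theorem mono_pos {t x y n : ℕ} (h : Chain L t x y n) :
    ∀ {x' y'}, x' ≤ x → y ≤ y' → Chain L t x' y' n := by
  induction h with
  | nil t x y => intro x' y' _ _; exact nil _ _ _
  | skip _ ih => intro x' y' hx hy; exact skip (ih hx hy)
  | cons h1 h2 h3 h4 h5 _ => intro x' y' hx hy; exact cons h1 h2 (hx.trans h3) (h4.trans_le hy) h5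

theorem mono_time {t t' x y n : ℕ} (h : Chain L t x y n) (ht : t ≤ t') : Chain L t' x y n := by
  induction ht with
  | refl => exact h
  | step _ ih => exact skip ih

theorem mono {t t' x x' y y' n : ℕ} (h : Chain L t x y n) (ht : t ≤ t') (hx : x' ≤ x)
    (hy : y ≤ y') : Chain L t' x' y' n :=
  (h.mono_pos hx hy).mono_time ht

/-- The shapes `L t` grow with `t`. -/
theorem shape_mono (hL : ∀ t, RookStrip (L t) (L (t + 1))) {t t' x y : ℕ} (ht : t ≤ t')
    (h : L t x y) : L t' x y := by
  induction ht with
  | refl => exact h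
  | step _ ih => exact (hL _).le ih

/-- Shapes are closed under moving up and left, so if `(x, y')` is missing, column `y'` is empty in
all rows from `x` on and no chain can use it. -/
theorem trunc (hL : ∀ t, RookStrip (L t) (L (t + 1))) {t x y n : ℕ} (h : Chain L t x y n) :
    ∀ {y'}, y = y' + 1 → ¬ L t x y' → Chain L t x y' n := by
  induction h with
  | nil t x y => intro y' _ _; exact nil _ _ _
  | skip _ ih => intro y' hy hn; exact skip (ih hy fun h => hn ((hL _).le h))
  | @cons t x y n p s h1 h2 h3 h4 h5 _ =>
    intro y' hy hn
    refine cons h1 h2 h3 (lt_of_le_of_ne (by omega) ?_) h5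
    rintro rfl
    exact hn ((hL (t + 1)).ideal h1 h3 le_rfl)

theorem letter {t t' x y : ℕ} (ht : t ≤ t')
    (h0 : ¬ L t x y) (h1 : L t' x y) : ∃ τ, t ≤ τ ∧ τ < t' ∧ L (τ + 1) x y ∧ ¬ L τ x y := by
  induction ht with
  | refl => exact absurd h1 h0
  | @step m hm ih =>
    by_cases h : L m x y
    · obtain ⟨τ, a, b, c⟩ := ih h
      exact ⟨τ, a, by omega, c⟩
    · exact ⟨m, hm, by omega, h1, h⟩

/-- Boxes of a chain in row `x` can be replaced by the boxes below them. -/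
theorem shift_down (hL : ∀ t, RookStrip (L t) (L (t + 1))) {t x y n : ℕ} (h : Chain L t x y n) :
    ∀ {T}, t ≤ T → (∀ s < y, L T (x + 1) s) → Chain L T (x + 1) y n := by
  induction h with
  | nil t x y => intro T _ _; exact nil _ _ _
  | skip _ ih => intro T hT hy; exact ih (by omega) hy
  | @cons t x y n p s h1 h2 h3 h4 h5 ih =>
    intro T hT hy
    rcases h3.eq_or_lt with rfl | h3
    · have h6 : ¬ L t (x + 1) s := fun h => h2 ((hL t).ideal h (Nat.le_succ _) le_rfl)
      obtain ⟨τ, a, b, c, d⟩ := letter (by omega) h6 (hy s h4)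
      refine mono (cons c d le_rfl h4 (ih a ?_)) b le_rfl le_rfl
      intro s' hs'
      exact (hL τ).right ((hL (τ + 1)).ideal c le_rfl hs')
    · exact mono (cons h1 h2 h3 h4 h5) hT le_rfl le_rfl

/-- Chains survive a strip of the growth diagram from the outer to the inner boundary. -/
theorem outer_to_inner (hS : ∀ t, Square (L t) (K t) (L (t + 1)) (K (t + 1))) {t x y n : ℕ}
    (h : Chain K t x y n) : Chain L t x y n ∨
      ∃ x' ρ τ n', x = x' + 1 ∧ ρ < y ∧ K t x ρ ∧ ¬ L t x ρ ∧ τ < t ∧ L (τ + 1) x' ρ ∧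
        ¬ L τ x' ρ ∧ n = n' + 1 ∧ Chain L τ x' ρ n' := by
  -- The second alternative is the only defect that can arise: the last box of the chain has slid up
  -- from row `x` to row `x - 1`, and a bullet lies directly below it. The induction must show that
  -- every later event repairs this defect or reproduces it.
  have hL : ∀ t, RookStrip (L t) (L (t + 1)) := fun t => (hS t).lm
  induction h with
  | nil t x y => exact Or.inl (nil _ _ _)
  | @skip t x y n _ ih =>
    rcases ih with h | ⟨x', ρ, τ, n', rfl, h1, h2, h3, h4, h5, h6, rfl, h7⟩
    · exact Or.inl h.skip
    -- If the bullet is filled, its box replaces the last box, and the rest of the chain is pushed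
    -- down into row `x` where necessary.
    · by_cases h : L (t + 1) (x' + 1) ρ
      · refine Or.inl (cons h h3 le_rfl h1 (shift_down hL h7 h4.le fun s hs => ?_))
        exact (hS t).lk.right ((hS t).kn.ideal h2 le_rfl hs)
      · exact Or.inr ⟨x', ρ, τ, n', rfl, h1, (hS t).kn.le h2, h, by omega, h5, h6, rfl, h7⟩
  | @cons t x y n p s k1 k2 k3 k4 _ ih =>
    rcases ih with h | ⟨p', ρ, τ, n', rfl, h1, h2, h3, h4, h5, h6, rfl, h7⟩
    · by_cases hm : L (t + 1) p s
      · exact Or.inl (cons hm (fun h => k2 ((hS t).lk.le h)) k3 k4 h)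
      · rcases (hS t).join k1 with h' | h' | ⟨s', rfl, h'⟩ | ⟨p', rfl, h'⟩
        · exact absurd h' k2
        · exact absurd h' hm
        · exact Or.inl (cons ((hS t).mn.right k1) h' k3 (by omega) (trunc hL h rfl h'))
        · have hm' := (hS t).mn.down k1
          have h8 := h.mono_pos (Nat.le_succ p') le_rfl
          rcases k3.eq_or_lt with rfl | k3
          · exact Or.inr ⟨p', s, t, n, rfl, k4, k1, hm, by omega, hm', h', rfl, h8⟩
          · exact Or.inl (cons hm' h' (by omega) k4 h8)
    -- A new box of `K` in the bullet's row must be the right neighbour of the bullet. The box above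
    -- this neighbour is then filled in `L` and extends the defective chain one row higher.
    · have hs : s = ρ + 1 := by
        by_contra hne
        exact h3 ((hS t).lk.right ((hS t).kn.right ((hS (t + 1)).kn.ideal
          k1 le_rfl (by omega))))
      subst hs
      have h8 : L (t + 1) p' (ρ + 1) := (hS t).mn.down k1
      have h9 : ¬ L τ p' (ρ + 1) := fun h => h6 ((hL τ).ideal h le_rfl (Nat.le_succ _))
      obtain ⟨τ', a, b, c, d⟩ := letter (by omega) h9 h8
      have hne : τ ≠ τ' := by
        rintro rfl
        exact h6 ((hL τ).right c)
      have h10 : Chain L τ' p' (ρ + 1) (n' + 1) :=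
        mono (cons h5 h6 le_rfl (Nat.lt_succ_self _) h7) (by omega) le_rfl le_rfl
      rcases k3.eq_or_lt with rfl | k3
      · refine Or.inr ⟨p', ρ + 1, τ', n' + 1, rfl, k4, k1, ?_, b, c, d, rfl, h10⟩
        exact fun h => h3 ((hL t).right h)
      · exact Or.inl (mono (cons c d le_rfl (Nat.lt_succ_self _) h10) b (by omega) (by omega))

/-- Chains survive a strip of the growth diagram from the inner to the outer boundary. -/
theorem inner_to_outer (hS : ∀ t, Square (L t) (K t) (L (t + 1)) (K (t + 1))) {t x y n : ℕ}
    (h : Chain L t x y n) : Chain K t x y n ∨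
      ∃ p s τ n', y = s + 1 ∧ x ≤ p ∧ τ < t ∧ K (τ + 1) p y ∧ ¬ K τ p y ∧ n = n' + 1 ∧
        Chain K τ p y n' ∧ ∀ T, K T (p + 1) s → Chain K T (p + 1) y (n' + 1) := by
  -- Here the defect is a last box that has been pulled back right into the forbidden column `y`.
  -- The final clause keeps a substitute ready: once `(p + 1, s)` is filled, there is an equally
  -- long chain within columns below `y`, one row lower.
  have hK : ∀ t, RookStrip (K t) (K (t + 1)) := fun t => (hS t).kn
  induction h with
  | nil t x y => exact Or.inl (nil _ _ _)
  | @skip t x y n _ ih =>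
    rcases ih with h | ⟨p, s, τ, n', h0, h1, h2, h3⟩
    · exact Or.inl h.skip
    · exact Or.inr ⟨p, s, τ, n', h0, h1, by omega, h3⟩
  | @cons t x y n p s k1 k2 k3 k4 _ ih =>
    rcases ih with h | ⟨p', s', τ, n', rfl, h1, h2, h3, h4, rfl, h5, h6⟩
    · by_cases hk : K t p s
      · rcases (hS t).meet hk k1 with h' | h' | h'
        · exact absurd h' k2
        · have hk' : ¬ K t p (s + 1) := fun h => k2 ((hS t).lk.right h)
          rcases (Nat.succ_le_of_lt k4).eq_or_lt with rfl | hy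
          · refine Or.inr ⟨p, s, t, n, rfl, k3, by omega, h', hk', rfl,
              h.mono_pos le_rfl (Nat.le_succ _), fun T hT => ?_⟩
            have h8 : ¬ K t (p + 1) s := fun h => k2 ((hS t).lk.down h)
            have htT : t ≤ T := by
              by_contra hlt
              exact h8 (shape_mono hK (by omega) hT)
            obtain ⟨σ, a, b, c, d⟩ := letter htT h8 hT
            refine mono (cons c d le_rfl (Nat.lt_succ_self _) (shift_down hK h a fun r hr => ?_))
              b le_rfl le_rfl
            exact (hK σ).right ((hK (σ + 1)).ideal c le_rfl hr)
          · exact Or.inl (cons h' hk' k3 hy (h.mono_pos le_rfl (Nat.le_succ _)))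
        · have hk' : ¬ K t (p + 1) s := fun h => k2 ((hS t).lk.down h)
          refine Or.inl (cons h' hk' (by omega) k4 (shift_down hK h le_rfl fun s' hs' => ?_))
          exact (hK t).right ((hK (t + 1)).ideal h' le_rfl hs')
      · exact Or.inl (cons ((hS t).mn.le k1) hk k3 k4 h)
    · have hk : K t p' (s' + 1) := shape_mono hK (by omega) h3
      -- A new box of `L` in the column of the defective last box must be in its row as well:
      -- otherwise it would lie above a box of `K t` and belong to `L t` already.
      have hp : p = p' := by
        by_contra hne
        exact k2 ((hS t).lk.down ((hK t).ideal hk (by omega) le_rfl))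
      subst hp
      rcases (hS t).meet hk k1 with h' | h' | h'
      · exact absurd h' k2
      · have hk' : ¬ K t p (s' + 1 + 1) := fun h => k2 ((hS t).lk.right h)
        have h8 : Chain K t p (s' + 1 + 1) (n' + 1) :=
          mono (cons h3 h4 le_rfl (Nat.lt_succ_self _) h5) h2 le_rfl le_rfl
        rcases (Nat.succ_le_of_lt k4).eq_or_lt with rfl | hy
        · refine Or.inr ⟨p, s' + 1, t, n' + 1, rfl, k3, by omega, h', hk', rfl, h8,
            fun T hT => ?_⟩
          have h9 : ¬ K t (p + 1) (s' + 1) := fun h => k2 ((hS t).lk.down h)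
          have htT : t ≤ T := by
            by_contra hlt
            exact h9 (shape_mono hK (by omega) hT)
          obtain ⟨σ, a, b, c, d⟩ := letter htT h9 hT
          exact mono (cons c d le_rfl (Nat.lt_succ_self _) (h6 σ ((hK σ).right c))) b le_rfl le_rfl
        · exact Or.inl (cons h' hk' k3 hy h8)
      · have hk' : ¬ K t (p + 1) (s' + 1) := fun h => k2 ((hS t).lk.down h)
        exact Or.inl (cons h' hk' (by omega) k4 (h6 t ((hK t).right h')))

/-- Chains in the whole `r × c` rectangle are preserved by a strip of the growth diagram. -/
theorem strip (hS : ∀ t, Square (L t) (K t) (L (t + 1)) (K (t + 1))) {t c n : ℕ}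
    (hc : ∀ {t x y}, K t x y → y < c) : Chain L t 0 c n ↔ Chain K t 0 c n := by
  constructor
  · intro h
    -- In the whole rectangle both defects are impossible: there is no column `c` and no row above
    -- row 0.
    rcases inner_to_outer hS h with h | ⟨p, s, τ, n', -, -, -, h, -⟩
    · exact h
    · exact absurd (hc h) (lt_irrefl _)
  · intro h
    rcases outer_to_inner hS h with h | ⟨x', ρ, τ, n', h, -⟩
    · exact h
    · omega

theorem le_col {t x y n : ℕ} (h : Chain L t x y n) : n ≤ y := by
  induction h with
  | nil => exact Nat.zero_le _
  | skip _ ih => exact ih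
  | cons => omega

/-- Columns filled by the inner shape do not contribute to chains. -/
theorem le_col_sub (hL : ∀ t, RookStrip (L t) (L (t + 1))) {r b : ℕ}
    (hr : ∀ {t x y}, L t x y → x < r) (hb : ∀ {x y}, x < r → y < b → L 0 x y)
    {t x y n : ℕ} (h : Chain L t x y n) : n ≤ y - b := by
  induction h with
  | nil => exact Nat.zero_le _
  | skip _ ih => exact ih
  | @cons t x y n p s k1 k2 k3 k4 _ ih =>
    have : ¬ s < b := fun hs => k2 (shape_mono hL (Nat.zero_le _) (hb (hr k1) hs))
    omega

/-- A row segment of the skew shape `L t / L 0` gives a chain. -/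
theorem of_row (hL : ∀ t, RookStrip (L t) (L (t + 1))) {x b : ℕ} (hb : ∀ y, L 0 x y → y < b)
    (n : ℕ) : ∀ {t}, (∀ y < b + n, L t x y) → Chain L t x (b + n) n := by
  induction n with
  | zero => intro t _; exact nil _ _ _
  | succ n ih =>
    intro t ht
    obtain ⟨τ, -, hb', hc, hd⟩ := letter (Nat.zero_le t)
      (fun h => absurd (hb _ h) (by omega)) (ht (b + n) (by omega))
    refine mono (cons hc hd le_rfl (Nat.lt_succ_self _) (ih fun y hy => ?_)) hb' le_rfl le_rfl
    exact (hL τ).right ((hL (τ + 1)).ideal hc le_rfl hy)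

/-- Chains in a straight shape are at most as long as its first row. -/
theorem straight_iff (hL : ∀ t, RookStrip (L t) (L (t + 1))) (h0 : ∀ x y, ¬ L 0 x y)
    {t c n : ℕ} (hc : ∀ {y}, L t 0 y → y < c) : Chain L t 0 c (n + 1) ↔ L t 0 n := by
  constructor
  · intro h
    by_contra hn
    have key : ∀ d, Chain L t 0 (c - d) (n + 1) := by
      intro d
      induction d with
      | zero => exact h
      | succ d ih =>
        rcases Nat.lt_or_ge n (c - (d + 1)) with hd | hd
        · refine trunc hL ih (by omega) fun h' => hn ((hL t).ideal h' le_rfl hd.le)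
        · by_cases h2 : n < c - d
          · have h3 : c - (d + 1) = n := by omega
            exact trunc hL ih (by omega) (h3 ▸ hn)
          · exact absurd (le_col ih) (by omega)
    have := le_col (key c)
    omega
  · intro h
    have := of_row hL (x := 0) (b := 0) (fun y hy => absurd hy (h0 _ _)) (n + 1)
      (t := t) (fun y hy => (hL t).ideal h le_rfl (by omega))
    exact this.mono_pos le_rfl (by have := hc h; omega)

/-- Chains in the skew shape whose outer shape is an `r × c` rectangle are controlled by the last
row of the inner shape. -/
theorem skew_iff (hL : ∀ t, RookStrip (L t) (L (t + 1))) {r c n t : ℕ}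
    (hr : ∀ {t x y}, L t x y → x < r + 1) (ht : ∀ {x y}, x < r + 1 → y < c → L t x y)
    (hn : n + 1 ≤ c) : Chain L t 0 c (n + 1) ↔ ¬ L 0 r (c - (n + 1)) := by
  constructor
  · intro h h0
    have := le_col_sub hL hr (b := c - (n + 1) + 1)
      (fun {x y} hx hy => (hL 0).ideal h0 (by omega) (by omega)) h
    omega
  · intro h
    have := of_row hL (x := r) (b := c - (n + 1))
      (fun y hy => by
        by_contra hlt
        exact h ((hL 0).ideal hy le_rfl (by omega))) (n + 1) (t := t)
      (fun y hy => ht (by omega) (by omega))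
    exact this.mono_pos (Nat.zero_le _) (by omega)

end Chain

/-- In a rectangular growth diagram from the empty shape to an `r × c` rectangle, the last row of
one of the other two corner shapes determines the first row of the other. -/
theorem growth_rectangle {M : ℕ → ℕ → ℕ → ℕ → Prop} {a b r c : ℕ}
    (hS : ∀ u < a, ∀ v < b, Square (M u v) (M (u + 1) v) (M u (v + 1)) (M (u + 1) (v + 1)))
    (hu : ∀ v ≤ b, ∀ u < a, RookStrip (M u v) (M (u + 1) v))
    (hv : ∀ u ≤ a, ∀ v < b, RookStrip (M u v) (M u (v + 1)))
    (hM : ∀ u ≤ a, ∀ v ≤ b, ∀ {x x' y y'}, M u v x y → x' ≤ x → y' ≤ y → M u v x' y')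
    (hrc : ∀ u ≤ a, ∀ v ≤ b, ∀ {x y}, M u v x y → x < r + 1 ∧ y < c)
    (h0 : ∀ x y, ¬ M 0 0 x y) (h1 : ∀ {x y}, x < r + 1 → y < c → M a b x y)
    {n : ℕ} (hn : n + 1 ≤ c) : M 0 b 0 n ↔ ¬ M a 0 r (c - (n + 1)) := by
  -- Capping `t` at `b` makes the diagram constant beyond its border, so that the chain lemmas,
  -- stated for all times, apply; `Square.const` supplies the degenerate squares.
  have hR : ∀ u ≤ a, ∀ t, RookStrip (M u (min t b)) (M u (min (t + 1) b)) := by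
    intro u hu' t
    rcases Nat.lt_or_ge t b with h | h
    · rw [min_eq_left h.le, min_eq_left h]
      exact hv u hu' t h
    · rw [min_eq_right h, min_eq_right (by omega)]
      exact ⟨id, fun h => hM u hu' b le_rfl h (Nat.le_succ _) le_rfl,
        fun h => hM u hu' b le_rfl h le_rfl (Nat.le_succ _)⟩
  have key : ∀ u ≤ a, (Chain (fun t => M 0 (min t b)) b 0 c (n + 1) ↔
      Chain (fun t => M u (min t b)) b 0 c (n + 1)) := by
    intro u
    induction u with
    | zero => exact fun _ => Iff.rfl
    | succ u ih =>
      intro hu'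
      rw [ih (by omega)]
      refine Chain.strip (fun t => ?_) fun h => (hrc _ hu' _ (min_le_right _ _) h).2
      rcases Nat.lt_or_ge t b with h | h
      · simp only [min_eq_left h.le, min_eq_left (show t + 1 ≤ b from h)]
        exact hS u hu' t h
      · simp only [min_eq_right h, min_eq_right (show b ≤ t + 1 by omega)]
        exact Square.const (hu b le_rfl u hu') (hM _ hu' b le_rfl)
  have e1 := Chain.straight_iff (L := fun t => M 0 (min t b)) (hR 0 (Nat.zero_le _))
    (by simpa using h0) (t := b) (c := c) (n := n)
    (fun h => (hrc 0 (Nat.zero_le _) _ (min_le_right _ _) h).2)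
  have e2 := Chain.skew_iff (L := fun t => M a (min t b)) (hR a le_rfl) (t := b) (c := c) (n := n)
    (r := r) (fun h => (hrc a le_rfl _ (min_le_right _ _) h).1)
    (fun hx hy => by simpa using h1 hx hy) hn
  have := e1.symm.trans ((key a le_rfl).trans e2)
  simpa using this

/-! ### The states of gromotion as squares of a growth diagram -/

section Levels

variable {r c : ℕ}

/-- `b'` is immediately to the right of `b`, or immediately below `b`. -/
def Covers (b b' : Box r c) : Prop := RightOf b b' ∨ Below b b'

theorem adjacent_iff {b b' : Box r c} : Adjacent b b' ↔ Covers b b' ∨ Covers b' b := by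
  unfold Adjacent Covers
  tauto

theorem adjacent_comm {b b' : Box r c} : Adjacent b b' ↔ Adjacent b' b := by
  rw [adjacent_iff, adjacent_iff, or_comm]

/-- A numbering of the boxes that strictly increases along rows and columns. -/
def IsStrict (f : Box r c → ℕ) : Prop := ∀ b b', Covers b b' → f b < f b'

open Classical in
/-- The effect of a slide, where the bullets have level `2 * k`, and the sliding letter has level
`2 * k + 1`; after the slide, bullets have level `2 * k + 2`. -/
structure Slides (k : ℕ) (f g : Box r c → ℕ) : Prop where
  ne : ∀ b, f b ≠ 2 * k + 2
  other : ∀ {b}, f b ≠ 2 * k → f b ≠ 2 * k + 1 → g b = f b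
  bullet : ∀ {b}, f b = 2 * k →
    g b = if ∃ b', Adjacent b b' ∧ f b' = 2 * k + 1 then 2 * k + 1 else 2 * k + 2
  letter : ∀ {b}, f b = 2 * k + 1 →
    g b = if ∃ b', Adjacent b b' ∧ f b' = 2 * k then 2 * k + 2 else 2 * k + 1

theorem Slides.range {k : ℕ} {f g : Box r c → ℕ} (h : Slides k f g) (b : Box r c) :
    (f b < 2 * k ∧ g b = f b) ∨ (2 * k + 1 < f b ∧ g b = f b) ∨
      ((f b = 2 * k ∨ f b = 2 * k + 1) ∧ (g b = 2 * k + 1 ∨ g b = 2 * k + 2)) := by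
  by_cases h1 : f b = 2 * k
  · have := h.bullet h1
    split_ifs at this
    · exact Or.inr (Or.inr ⟨Or.inl h1, Or.inl this⟩)
    · exact Or.inr (Or.inr ⟨Or.inl h1, Or.inr this⟩)
  · by_cases h2 : f b = 2 * k + 1
    · have := h.letter h2
      split_ifs at this
      · exact Or.inr (Or.inr ⟨Or.inr h2, Or.inr this⟩)
      · exact Or.inr (Or.inr ⟨Or.inr h2, Or.inl this⟩)
    · have := h.other h1 h2
      omega

theorem Slides.isStrict {k : ℕ} {f g : Box r c → ℕ} (h : Slides k f g) (hf : IsStrict f) :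
    IsStrict g := by
  intro b b' hb
  have h0 := hf b b' hb
  have h1 := h.range b
  have h2 := h.range b'
  -- A bullet directly before the sliding letter is the only pair whose order is endangered. Being
  -- adjacent, both boxes change and trade levels.
  by_cases h3 : f b = 2 * k ∧ f b' = 2 * k + 1
  · have e1 := h.bullet h3.1
    have e2 := h.letter h3.2
    rw [if_pos ⟨b', adjacent_iff.2 (Or.inl hb), h3.2⟩] at e1
    rw [if_pos ⟨b, adjacent_iff.2 (Or.inr hb), h3.1⟩] at e2
    omega
  · have h4 := h.ne b'
    omega

/-- A set of boxes as a set of positions in the plane. -/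
def toShape (P : Box r c → Prop) (x y : ℕ) : Prop := ∃ b : Box r c, b.1.val = x ∧ b.2.val = y ∧ P b

theorem toShape_congr {P Q : Box r c → Prop} (h : ∀ b, P b ↔ Q b) : toShape P = toShape Q := by
  have : P = Q := funext fun b => propext (h b)
  rw [this]

theorem toShape_down {P Q : Box r c → Prop} (h : ∀ b b', Covers b b' → Q b' → P b) {x y : ℕ}
    (hQ : toShape Q (x + 1) y) : toShape P x y := by
  obtain ⟨b, hx, hy, hb⟩ := hQ
  exact ⟨(⟨x, by omega⟩, b.2), rfl, hy, h _ b (Or.inr ⟨hx, rfl⟩) hb⟩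

theorem toShape_right {P Q : Box r c → Prop} (h : ∀ b b', Covers b b' → Q b' → P b) {x y : ℕ}
    (hQ : toShape Q x (y + 1)) : toShape P x y := by
  obtain ⟨b, hx, hy, hb⟩ := hQ
  exact ⟨(b.1, ⟨y, by omega⟩), hx, rfl, h _ b (Or.inl ⟨rfl, hy⟩) hb⟩

theorem rookStrip_toShape {P Q : Box r c → Prop} (h1 : ∀ b, P b → Q b)
    (h2 : ∀ b b', Covers b b' → Q b' → P b) : RookStrip (toShape P) (toShape Q) where
  le := fun ⟨b, hx, hy, hb⟩ => ⟨b, hx, hy, h1 b hb⟩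
  down := toShape_down h2
  right := toShape_right h2

theorem toShape_val {P : Box r c → Prop} {b : Box r c} : toShape P b.1.val b.2.val ↔ P b := by
  constructor
  · rintro ⟨b', hx, hy, hb⟩
    have : b' = b := Prod.ext (Fin.ext hx) (Fin.ext hy)
    exact this ▸ hb
  · exact fun h => ⟨b, rfl, rfl, h⟩

/-- Strictness orients the adjacencies: a sliding letter next to a bullet lies to its right or below
it, never on its left or above it. -/
theorem Slides.square {k : ℕ} {f g : Box r c → ℕ} (h : Slides k f g) (hf : IsStrict f) :
    Square (toShape fun b => f b < 2 * k) (toShape fun b => f b < 2 * k + 1)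
      (toShape fun b => g b < 2 * k + 2) (toShape fun b => f b < 2 * k + 2) := by
  have hg := h.isStrict hf
  refine ⟨rookStrip_toShape ?_ ?_, rookStrip_toShape ?_ ?_, rookStrip_toShape ?_ ?_,
    rookStrip_toShape ?_ ?_, ?_, ?_⟩
  · intro b hb
    omega
  · intro b b' hb h1
    have := hf b b' hb
    omega
  · intro b hb
    have := h.range b
    omega
  · intro b b' hb h1
    have := hg b b' hb
    have := h.range b
    omega
  · intro b hb
    omega
  · intro b b' hb h1
    have := hf b b' hb
    omega
  · intro b hb
    have := h.range b
    omega
  · intro b b' hb h1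
    have := hg b b' hb
    have := h.range b
    have := h.range b'
    omega
  · rintro x y ⟨b, rfl, rfl, h1⟩ h2
    rw [toShape_val] at h2 ⊢
    by_cases h3 : f b < 2 * k
    · exact Or.inl h3
    · have h4 := h.bullet (b := b) (by omega)
      split_ifs at h4 with h5
      · obtain ⟨b', h6, h7⟩ := h5
        rcases adjacent_iff.1 h6 with h6 | h6
        · rcases h6 with h6 | h6
          · exact Or.inr (Or.inl ⟨b', congrArg Fin.val h6.1, h6.2, by omega⟩)
          · exact Or.inr (Or.inr ⟨b', h6.1, congrArg Fin.val h6.2, by omega⟩)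
        · have := hf _ _ h6
          omega
      · omega
  · rintro x y ⟨b, rfl, rfl, h1⟩
    rw [toShape_val, toShape_val]
    by_cases h3 : f b < 2 * k + 1
    · exact Or.inl h3
    · have h4 := h.letter (b := b) (by omega)
      split_ifs at h4 with h5
      · obtain ⟨b', h6, h7⟩ := h5
        rcases adjacent_iff.1 h6 with h6 | h6
        · have := hf _ _ h6
          omega
        · rcases h6 with h6 | h6
          · refine Or.inr (Or.inr (Or.inl ⟨b'.2.val, h6.2, ?_⟩))
            rw [h6.1, toShape_val]
            omega
          · refine Or.inr (Or.inr (Or.inr ⟨b'.1.val, h6.1, ?_⟩))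
            rw [h6.2, toShape_val]
            omega
      · omega

end Levels

/-! ### Gromotion states as level functions, and the shapes they define -/

section States

variable {r c : ℕ}

/-- A filling of the rectangle with letters of the alphabet `A` that strictly increases along rows
and columns. -/
structure IncOn (A : List ℕ) (T : Filling r c) : Prop where
  mem : ∀ b, T b ∈ A
  strict : IsStrict fun b => A.idxOf (T b)

/-- The state of gromotion after the slides for the first `k` letters of `R`. -/
def state (a : ℕ) (R : List ℕ) (T : Filling r c) (k : ℕ) : BulletFilling r c :=
  (R.take k).foldl slide (delete a T)

/-- The level of an entry in the `k`-th state: bullets lie between processed and unprocessed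
letters. -/
def level (R : List ℕ) (k : ℕ) : Option ℕ → ℕ
  | none => 2 * k
  | some v => 2 * R.idxOf v + 1

theorem state_succ (a : ℕ) (R : List ℕ) (T : Filling r c) {k : ℕ} (hk : k < R.length) :
    state a R T (k + 1) = slide (state a R T k) R[k] := by
  unfold state
  rw [← List.take_append_getElem hk, List.foldl_append]
  rfl

theorem slide_none {S : BulletFilling r c} {β : ℕ} {b : Box r c} (h : S b = none)
    [Decidable (∃ b', Adjacent b b' ∧ S b' = some β)] :
    slide S β b = if ∃ b', Adjacent b b' ∧ S b' = some β then some β else none := by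
  unfold slide
  rw [if_neg (by simp [InC, h])]
  by_cases h' : ∃ b', Adjacent b b' ∧ S b' = some β
  · obtain ⟨b', h1, h2⟩ := h'
    rw [if_pos ⟨h, b', h1, h2, b, adjacent_comm.1 h1, h⟩, if_pos ⟨b', h1, h2⟩]
  · rw [if_neg (fun h2 => h' (by obtain ⟨-, b', h3, h4⟩ := h2; exact ⟨b', h3, h4.1⟩)), if_neg h', h]

theorem slide_letter {S : BulletFilling r c} {β : ℕ} {b : Box r c} (h : S b = some β)
    [Decidable (∃ b', Adjacent b b' ∧ S b' = none)] :
    slide S β b = if ∃ b', Adjacent b b' ∧ S b' = none then none else some β := by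
  unfold slide
  by_cases h' : ∃ b', Adjacent b b' ∧ S b' = none
  · rw [if_pos ⟨h, h'⟩, if_pos h']
  · rw [if_neg (fun h2 => h' h2.2), if_neg (by simp [InB, h]), if_neg h', h]

theorem slide_other {S : BulletFilling r c} {β : ℕ} {b : Box r c} (h : S b ≠ none)
    (h' : S b ≠ some β) : slide S β b = S b := by
  unfold slide
  rw [if_neg (fun h2 => h' h2.1), if_neg (fun h2 => h h2.1)]

theorem slide_mem {S : BulletFilling r c} {β : ℕ} (b : Box r c) :
    slide S β b = S b ∨ slide S β b = none ∨ slide S β b = some β := by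
  unfold slide
  split_ifs
  · exact Or.inr (Or.inl rfl)
  · exact Or.inr (Or.inr rfl)
  · exact Or.inl rfl

variable {a : ℕ} {R : List ℕ} {T : Filling r c}

theorem state_mem (hT : ∀ b, T b ∈ a :: R) {k : ℕ} (hk : k ≤ R.length) (b : Box r c) {v : ℕ}
    (hv : state a R T k b = some v) : v ∈ R := by
  induction k generalizing b v with
  | zero =>
    simp only [state, List.take_zero, List.foldl_nil, delete] at hv
    split_ifs at hv with h
    have := hT b
    simp only [Option.some.injEq] at hv
    subst hv
    exact (List.mem_cons.1 this).resolve_left h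
  | succ k ih =>
    rw [state_succ _ _ _ hk] at hv
    rcases slide_mem (S := state a R T k) (β := R[k]) b with h | h | h
    · exact ih (by omega) b (h ▸ hv)
    · rw [h] at hv
      cases hv
    · rw [h] at hv
      cases hv
      exact List.getElem_mem hk

theorem level_eq_bullet {k : ℕ} {o : Option ℕ} : level R k o = 2 * k ↔ o = none := by
  cases o with
  | none => simp [level]
  | some v => simp only [level, reduceCtorEq, iff_false]; omega

theorem level_eq_letter (hR : R.Nodup) {k : ℕ} (hk : k < R.length) {o : Option ℕ} :
    level R k o = 2 * k + 1 ↔ o = some R[k] := by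
  cases o with
  | none => simp [level]
  | some v =>
    simp only [level, Option.some.injEq]
    constructor
    · intro h
      have h1 : R.idxOf v = k := by omega
      subst h1
      simp
    · rintro rfl
      rw [hR.idxOf_getElem]

theorem state_slides (hR : R.Nodup) {k : ℕ} (hk : k < R.length) :
    Slides k (fun b => level R k (state a R T k b))
      (fun b => level R (k + 1) (state a R T (k + 1) b)) := by
  classical
  constructor
  · intro b
    cases state a R T k b <;> simp only [level] <;> omega
  · intro b h1 h2
    rw [Ne, level_eq_bullet] at h1
    rw [Ne, level_eq_letter hR hk] at h2
    simp only [state_succ _ _ _ hk, slide_other h1 h2]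
    cases h : state a R T k b with
    | none => exact absurd h h1
    | some v => rfl
  · intro b h
    rw [level_eq_bullet] at h
    simp only [state_succ _ _ _ hk, slide_none h, level_eq_letter hR hk]
    split_ifs
    · simp [level, hR.idxOf_getElem]
    · rfl
  · intro b h
    rw [level_eq_letter hR hk] at h
    simp only [state_succ _ _ _ hk, slide_letter h, level_eq_bullet]
    split_ifs
    · rfl
    · simp [level, hR.idxOf_getElem]

/-- The truncated subtraction sends the deleted letter, of index 0, to the bullet level 0. -/
theorem level_zero (b : Box r c) :
    level R 0 (state a R T 0 b) = 2 * (a :: R).idxOf (T b) - 1 := by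
  simp only [state, List.take_zero, List.foldl_nil, delete]
  split_ifs with h
  · simp [level, h]
  · rw [List.idxOf_cons_ne _ (Ne.symm h)]
    simp only [level]
    omega

theorem state_isStrict (hA : (a :: R).Nodup) (hT : IncOn (a :: R) T) {k : ℕ}
    (hk : k ≤ R.length) : IsStrict fun b => level R k (state a R T k b) := by
  induction k with
  | zero =>
    intro b b' hb
    have := hT.strict b b' hb
    simp only [level_zero]
    simp only at this
    omega
  | succ k ih => exact (state_slides hA.of_cons hk).isStrict (ih (by omega))

/-- A letter whose slide is over is never touched again, so the boxes of the first `k` processed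
letters are already final. -/
theorem level_lt_of_le (hA : (a :: R).Nodup) {k m : ℕ} (hkm : k ≤ m) (hm : m ≤ R.length)
    (b : Box r c) :
    level R m (state a R T m b) < 2 * k ↔ level R k (state a R T k b) < 2 * k := by
  induction hkm with
  | refl => exact Iff.rfl
  | @step m hkm ih =>
    rw [← ih (by omega)]
    have := (state_slides (a := a) (T := T) hA.of_cons (show m < R.length by omega)).range b
    have h' : k ≤ m := hkm
    simp only [Nat.succ_eq_add_one]
    omega

/-- The first `k` slides only rearrange bullets and the first `k` letters among the boxes that they
jointly occupy, so this region can be read off from `T`. -/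
theorem level_le_of_le (hA : (a :: R).Nodup) {k : ℕ} (hm : k ≤ R.length) (b : Box r c)
    {m : ℕ} (hkm : m ≤ k) :
    level R m (state a R T m b) < 2 * k + 1 ↔ level R k (state a R T k b) < 2 * k + 1 := by
  induction k generalizing m with
  | zero =>
    obtain rfl : m = 0 := by omega
    rfl
  | succ k ih =>
    rcases hkm.eq_or_lt with rfl | hkm
    · rfl
    · have key : ∀ j, j ≤ k → (level R j (state a R T j b) < 2 * (k + 1) + 1 ↔
          level R (j + 1) (state a R T (j + 1) b) < 2 * (k + 1) + 1) := by
        intro j hj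
        have := (state_slides (a := a) (T := T) hA.of_cons (show j < R.length by omega)).range b
        omega
      have : ∀ d, m + d ≤ k + 1 → (level R m (state a R T m b) < 2 * (k + 1) + 1 ↔
          level R (m + d) (state a R T (m + d) b) < 2 * (k + 1) + 1) := by
        intro d
        induction d with
        | zero => exact fun _ => Iff.rfl
        | succ d ihd =>
          intro hd
          rw [ihd (by omega)]
          exact key (m + d) (by omega)
      have h := this (k + 1 - m) (by omega)
      rwa [show m + (k + 1 - m) = k + 1 by omega] at h

theorem gromotion_cons (b : Box r c) :
    gromotion (a :: R) T b = (state a R T R.length b).getD a := by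
  simp [gromotion, state]

theorem grow_cons : grow (a :: R) = R ++ [a] := by simp [grow]

theorem idxOf_gromotion (hA : (a :: R).Nodup) (hT : IncOn (a :: R) T) (b : Box r c) :
    (R ++ [a]).idxOf (gromotion (a :: R) T b) =
      level R R.length (state a R T R.length b) / 2 := by
  rw [gromotion_cons]
  cases h : state a R T R.length b with
  | none =>
    have : a ∉ R := (List.nodup_cons.1 hA).1
    simp [level, List.idxOf_append, this]
  | some v =>
    have := state_mem hT.mem le_rfl b h
    simp only [Option.getD_some, level, List.idxOf_append, this, if_true]
    omega

theorem gromotion_incOn (hA : (a :: R).Nodup) (hT : IncOn (a :: R) T) :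
    IncOn (grow (a :: R)) (gromotion (a :: R) T) := by
  rw [grow_cons]
  constructor
  · intro b
    rw [gromotion_cons]
    cases h : state a R T R.length b with
    | none => simp
    | some v => simp [state_mem hT.mem le_rfl b h]
  · intro b b' hb
    have := state_isStrict hA hT le_rfl b b' hb
    simp only [idxOf_gromotion hA hT]
    have h1 : ∀ b, level R R.length (state a R T R.length b) = 2 * R.length ∨
        level R R.length (state a R T R.length b) % 2 = 1 ∧
        level R R.length (state a R T R.length b) < 2 * R.length := by
      intro b
      cases h : state a R T R.length b with
      | none => exact Or.inl rfl
      | some v =>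
        have := List.idxOf_lt_length_of_mem (state_mem hT.mem le_rfl b h)
        simp only [level]
        omega
    have h2 := h1 b
    have h3 := h1 b'
    simp only at this
    omega

theorem inner_iff (hA : (a :: R).Nodup) (hT : IncOn (a :: R) T) {k : ℕ} (hk : k ≤ R.length)
    (b : Box r c) :
    level R k (state a R T k b) < 2 * k ↔
      (grow (a :: R)).idxOf (gromotion (a :: R) T b) < k := by
  rw [grow_cons, idxOf_gromotion hA hT, ← level_lt_of_le hA hk le_rfl b]
  omega

theorem outer_iff (hA : (a :: R).Nodup) {k : ℕ} (hk : k ≤ R.length)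
    (b : Box r c) :
    level R k (state a R T k b) < 2 * k + 1 ↔ (a :: R).idxOf (T b) < k + 1 := by
  rw [← level_le_of_le hA hk b (Nat.zero_le k), level_zero]
  omega

theorem gromotion_rookStrip (hA : (a :: R).Nodup) (hT : IncOn (a :: R) T) {k : ℕ}
    (hk : k ≤ R.length) :
    RookStrip (toShape fun b => (grow (a :: R)).idxOf (gromotion (a :: R) T b) < k)
      (toShape fun b => (a :: R).idxOf (T b) < k + 1) := by
  rw [toShape_congr fun b => (inner_iff hA hT hk b).symm,
    toShape_congr fun b => (outer_iff hA hk b).symm]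
  have hf := state_isStrict hA hT hk
  refine rookStrip_toShape (fun b hb => by omega) fun b b' hb h => ?_
  have := hf b b' hb
  simp only at this
  omega

theorem gromotion_square (hA : (a :: R).Nodup) (hT : IncOn (a :: R) T) {k : ℕ}
    (hk : k < R.length) :
    Square (toShape fun b => (grow (a :: R)).idxOf (gromotion (a :: R) T b) < k)
      (toShape fun b => (a :: R).idxOf (T b) < k + 1)
      (toShape fun b => (grow (a :: R)).idxOf (gromotion (a :: R) T b) < k + 1)
      (toShape fun b => (a :: R).idxOf (T b) < k + 2) := by
  have := (state_slides (a := a) (T := T) hA.of_cons hk).square (state_isStrict hA hT hk.le)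
  rw [toShape_congr fun b => inner_iff hA hT hk.le b,
    toShape_congr fun b => outer_iff hA hk.le b] at this
  convert this using 1
  · exact toShape_congr fun b => (inner_iff hA hT (k := k + 1) hk b).symm
  · refine toShape_congr fun b => ?_
    rw [← outer_iff hA (k := k + 1) hk b]
    have h := state_slides (a := a) (T := T) hA.of_cons hk
    have h1 := h.range b
    have h2 := h.ne b
    omega

end States

/-! ### The first and the last row after `q` applications of gromotion -/

section Frame

variable {r c : ℕ} {q : ℕ}

theorem gromotionIter_succ (i : ℕ) (A : List ℕ) (T : Filling r c) :
    gromotionIter (i + 1) A T =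
      (grow (gromotionIter i A T).1, gromotion (gromotionIter i A T).1 (gromotionIter i A T).2) := by
  unfold gromotionIter
  rw [Function.iterate_succ_apply']

theorem gromotionIter_fst (i : ℕ) (A : List ℕ) (T : Filling r c) :
    (gromotionIter i A T).1 = A.rotate i := by
  induction i with
  | zero => simp [gromotionIter]
  | succ i ih => rw [gromotionIter_succ, ih, grow, List.rotate_rotate]

theorem stdAlphabet_nodup (q : ℕ) : (stdAlphabet q).Nodup := List.nodup_range'

theorem gromotionIter_nodup (i q : ℕ) (T : Filling r c) :
    (gromotionIter i (stdAlphabet q) T).1.Nodup := by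
  rw [gromotionIter_fst, List.nodup_rotate]
  exact stdAlphabet_nodup q

theorem gromotionIter_length (i q : ℕ) (T : Filling r c) :
    (gromotionIter i (stdAlphabet q) T).1.length = q := by
  rw [gromotionIter_fst, List.length_rotate, stdAlphabet, List.length_range']

theorem gromotionIter_full (q : ℕ) (T : Filling r c) :
    (gromotionIter q (stdAlphabet q) T).1 = stdAlphabet q := by
  rw [gromotionIter_fst]
  have : (stdAlphabet q).length = q := List.length_range'
  nth_rw 2 [← this]
  exact List.rotate_length _

theorem mem_stdAlphabet {v : ℕ} : v ∈ stdAlphabet q ↔ v ∈ Set.Icc 1 q := by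
  simp only [stdAlphabet, List.mem_range'_1, Set.mem_Icc]
  omega

theorem idxOf_stdAlphabet {v : ℕ} (hv : v ∈ Set.Icc 1 q) : (stdAlphabet q).idxOf v = v - 1 := by
  obtain ⟨h1, h2⟩ := hv
  have hl : v - 1 < (stdAlphabet q).length := by simp [stdAlphabet]; omega
  have : (stdAlphabet q)[v - 1] = v := by simp [stdAlphabet]; omega
  conv_lhs => rw [← this]
  exact (stdAlphabet_nodup q).idxOf_getElem _ _

theorem IsIncreasing.incOn {T : Filling r c} (hT : IsIncreasing q T) :
    IncOn (stdAlphabet q) T := by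
  refine ⟨fun b => mem_stdAlphabet.2 (hT.mem_alphabet b), fun b b' hb => ?_⟩
  simp only [idxOf_stdAlphabet (hT.mem_alphabet _)]
  have h1 := (hT.mem_alphabet b).1
  have : T b < T b' := by
    obtain ⟨x, y⟩ := b
    obtain ⟨x', y'⟩ := b'
    rcases hb with ⟨h1, h2⟩ | ⟨h1, h2⟩
    · simp only at h1 h2
      subst h1
      exact hT.row_strictMono _ (Fin.lt_def.2 (by omega))
    · simp only at h1 h2
      subst h2
      exact hT.col_strictMono _ (Fin.lt_def.2 (by omega))
  omega

theorem gromotionIter_incOn {T : Filling r c} (hT : IncOn (stdAlphabet q) T) (i : ℕ) :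
    IncOn (gromotionIter i (stdAlphabet q) T).1 (gromotionIter i (stdAlphabet q) T).2 := by
  induction i with
  | zero => exact hT
  | succ i ih =>
    have hA := gromotionIter_nodup i q T
    rw [gromotionIter_succ]
    generalize gromotionIter i (stdAlphabet q) T = p at ih hA
    obtain ⟨A, T'⟩ := p
    cases A with
    | nil => exact ih
    | cons a R => exact gromotion_incOn hA ih

/-- The shape of the `k` least letters of the `i`-th iterate of gromotion. -/
def lam (q : ℕ) (T : Filling r c) (i k : ℕ) : ℕ → ℕ → Prop :=
  toShape fun b =>
    (gromotionIter i (stdAlphabet q) T).1.idxOf ((gromotionIter i (stdAlphabet q) T).2 b) < k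

variable {T : Filling r c}

theorem lam_rookStrip_row (hT : IncOn (stdAlphabet q) T) (i k : ℕ) :
    RookStrip (lam q T i k) (lam q T i (k + 1)) := by
  refine rookStrip_toShape (fun b hb => by omega) fun b b' hb h => ?_
  have := (gromotionIter_incOn hT i).strict b b' hb
  simp only at this
  omega

theorem lam_ideal (hT : IncOn (stdAlphabet q) T) (i k : ℕ) {x x' y y' : ℕ}
    (h : lam q T i k x y) (hx : x' ≤ x) (hy : y' ≤ y) : lam q T i k x' y' :=
  (lam_rookStrip_row hT i k).ideal h hx hy

theorem lam_square (hT : IncOn (stdAlphabet q) T) (i : ℕ) {k : ℕ} (hk : k + 1 < q) :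
    Square (lam q T (i + 1) k) (lam q T i (k + 1)) (lam q T (i + 1) (k + 1))
      (lam q T i (k + 2)) := by
  have h1 := gromotionIter_incOn hT i
  have h2 := gromotionIter_nodup i q T
  have h3 := gromotionIter_length i q T
  unfold lam
  rw [gromotionIter_succ]
  generalize gromotionIter i (stdAlphabet q) T = p at *
  obtain ⟨A, T'⟩ := p
  cases A with
  | nil => simp only [List.length_nil] at h3; omega
  | cons a R =>
    simp only [List.length_cons] at h3
    exact gromotion_square h2 h1 (by omega)

theorem lam_rookStrip_col (hT : IncOn (stdAlphabet q) T) (i : ℕ) {k : ℕ} (hk : k < q) :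
    RookStrip (lam q T (i + 1) k) (lam q T i (k + 1)) := by
  have h1 := gromotionIter_incOn hT i
  have h2 := gromotionIter_nodup i q T
  have h3 := gromotionIter_length i q T
  unfold lam
  rw [gromotionIter_succ]
  generalize gromotionIter i (stdAlphabet q) T = p at *
  obtain ⟨A, T'⟩ := p
  cases A with
  | nil => simp only [List.length_nil] at h3; omega
  | cons a R =>
    simp only [List.length_cons] at h3
    exact gromotion_rookStrip h2 h1 (by omega)

theorem lam_zero (i x y : ℕ) : ¬ lam q T i 0 x y := by
  rintro ⟨b, -, -, h⟩
  exact absurd h (Nat.not_lt_zero _)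

theorem lam_full (hT : IncOn (stdAlphabet q) T) (i : ℕ) {x y : ℕ} (hx : x < r) (hy : y < c) :
    lam q T i q x y := by
  refine ⟨(⟨x, hx⟩, ⟨y, hy⟩), rfl, rfl, ?_⟩
  have := List.idxOf_lt_length_of_mem ((gromotionIter_incOn hT i).mem (⟨x, hx⟩, ⟨y, hy⟩))
  rwa [gromotionIter_length] at this

theorem lam_bound {i k x y : ℕ} (h : lam q T i k x y) : x < r ∧ y < c := by
  obtain ⟨b, rfl, rfl, -⟩ := h
  exact ⟨b.1.isLt, b.2.isLt⟩

/-- The rectangle runs from the empty shape `lam q T (s + m) 0` to the full shape `lam q T s q`; its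
other corners are the two shapes compared. -/
theorem lam_first_row {T : Filling (r + 1) c} (hT : IncOn (stdAlphabet q) T) (s : ℕ) {m n : ℕ}
    (hm : m ≤ q) (hn : n + 1 ≤ c) :
    lam q T (s + m) (q - m) 0 n ↔ ¬ lam q T s m r (c - (n + 1)) := by
  have := growth_rectangle (M := fun u v => lam q T (s + m - u) (u + v)) (a := m) (b := q - m)
    (r := r) (c := c) ?_ ?_ ?_ ?_ ?_ ?_ ?_ hn
  · simpa using this
  · intro u hu v hv
    obtain ⟨i, hi⟩ : ∃ i, s + m - u = i + 1 := ⟨s + m - u - 1, by omega⟩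
    have h := lam_square hT i (k := u + v) (by omega)
    simp only [hi, show s + m - (u + 1) = i by omega, show u + 1 + v = u + v + 1 by omega,
      show u + (v + 1) = u + v + 1 by omega, show u + 1 + (v + 1) = u + v + 2 by omega]
    exact h
  · intro v hv u hu
    obtain ⟨i, hi⟩ : ∃ i, s + m - u = i + 1 := ⟨s + m - u - 1, by omega⟩
    have h := lam_rookStrip_col hT i (k := u + v) (by omega)
    simp only [hi, show s + m - (u + 1) = i by omega, show u + 1 + v = u + v + 1 by omega]
    exact h
  · intro u _ v _
    exact lam_rookStrip_row hT _ _
  · intro u _ v _ x x' y y' h hx hy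
    exact lam_ideal hT _ _ h hx hy
  · intro u _ v _ x y h
    exact lam_bound h
  · intro x y
    exact lam_zero _ _ _
  · intro x y hx hy
    have := lam_full hT s hx hy
    simpa [Nat.add_sub_cancel' hm] using this

/-- The same rectangle with its two directions exchanged, which the symmetry of the local rule
permits. -/
theorem lam_first_row' {T : Filling (r + 1) c} (hT : IncOn (stdAlphabet q) T) (s : ℕ) {m n : ℕ}
    (hm : m ≤ q) (hn : n + 1 ≤ c) :
    lam q T s m 0 n ↔ ¬ lam q T (s + m) (q - m) r (c - (n + 1)) := by
  have := growth_rectangle (M := fun v u => lam q T (s + m - u) (u + v)) (a := q - m) (b := m)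
    (r := r) (c := c) ?_ ?_ ?_ ?_ ?_ ?_ ?_ hn
  · simpa using this
  · intro v hv u hu
    obtain ⟨i, hi⟩ : ∃ i, s + m - u = i + 1 := ⟨s + m - u - 1, by omega⟩
    have h := (lam_square hT i (k := u + v) (by omega)).symm
    simp only [hi, show s + m - (u + 1) = i by omega, show u + 1 + v = u + v + 1 by omega,
      show u + (v + 1) = u + v + 1 by omega, show u + 1 + (v + 1) = u + v + 2 by omega]
    exact h
  · intro u _ v _
    exact lam_rookStrip_row hT _ _
  · intro v hv u hu
    obtain ⟨i, hi⟩ : ∃ i, s + m - u = i + 1 := ⟨s + m - u - 1, by omega⟩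
    have h := lam_rookStrip_col hT i (k := u + v) (by omega)
    simp only [hi, show s + m - (u + 1) = i by omega, show u + 1 + v = u + v + 1 by omega]
    exact h
  · intro u _ v _ x x' y y' h hx hy
    exact lam_ideal hT _ _ h hx hy
  · intro u _ v _ x y h
    exact lam_bound h
  · intro x y
    exact lam_zero _ _ _
  · intro x y hx hy
    have := lam_full hT s hx hy
    simpa [Nat.add_sub_cancel' hm] using this

theorem lam_frame {T : Filling (r + 1) c} (hT : IncOn (stdAlphabet q) T) {m x n : ℕ}
    (hm : m ≤ q) (hx : x = 0 ∨ x = r) (hn : n + 1 ≤ c) :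
    lam q T q m x n ↔ lam q T 0 m x n := by
  have e : m + (q - m) = q := by omega
  have e' : q - (q - m) = m := by omega
  rcases hx with rfl | rfl
  · have h1 := lam_first_row' hT 0 hm hn
    have h2 := lam_first_row hT m (Nat.sub_le q m) hn
    rw [zero_add] at h1
    rw [e, e'] at h2
    rw [h1, h2]
  · obtain ⟨n', hn', rfl⟩ : ∃ n', n' + 1 ≤ c ∧ n = c - (n' + 1) := ⟨c - (n + 1), by omega, by omega⟩
    have h1 := lam_first_row hT 0 hm hn'
    have h2 := lam_first_row' hT m (Nat.sub_le q m) hn'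
    rw [zero_add] at h1
    rw [e, e'] at h2
    exact not_iff_not.1 (h2.symm.trans h1)

/-- The first and the last row of a rectangular increasing tableau are restored by `q` applications
of gromotion. -/
theorem gromotionIter_frame {T : Filling (r + 1) c} (hT : IsIncreasing q T) (b : Box (r + 1) c)
    (hb : b.1.val = 0 ∨ b.1.val = r) : (gromotionIter q (stdAlphabet q) T).2 b = T b := by
  have hi := hT.incOn
  have key : ∀ m ≤ q, ((stdAlphabet q).idxOf ((gromotionIter q (stdAlphabet q) T).2 b) < m ↔
      (stdAlphabet q).idxOf (T b) < m) := by
    intro m hm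
    have := lam_frame hi hm hb b.2.isLt
    unfold lam at this
    rw [toShape_val, toShape_val, gromotionIter_full] at this
    exact this
  have hmem := (gromotionIter_incOn hi q).mem b
  rw [gromotionIter_full] at hmem
  have h1 := List.idxOf_lt_length_of_mem hmem
  have h2 := List.idxOf_lt_length_of_mem (hi.mem b)
  have hl : (stdAlphabet q).length = q := List.length_range'
  have : (stdAlphabet q).idxOf ((gromotionIter q (stdAlphabet q) T).2 b) =
      (stdAlphabet q).idxOf (T b) := by
    have h3 := key ((stdAlphabet q).idxOf ((gromotionIter q (stdAlphabet q) T).2 b) + 1) (by omega)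
    have h4 := key ((stdAlphabet q).idxOf (T b) + 1) (by omega)
    omega
  exact (List.idxOf_inj hmem).1 this

end Frame

/-! ### Movement of a letter between rows -/

section Movement

variable {r c : ℕ} {a : ℕ} {R : List ℕ} {T : Filling r c}

theorem slide_eq_some_iff_of_ne {S : BulletFilling r c} {β v : ℕ} (h : v ≠ β) (b : Box r c) :
    slide S β b = some v ↔ S b = some v := by
  constructor
  · intro h'
    rcases slide_mem (S := S) (β := β) b with h1 | h1 | h1 <;> rw [h1] at h'
    · exact h'
    · cases h'
    · exact absurd (Option.some.inj h').symm h
  · intro h'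
    rw [slide_other (by simp [h']) (by simp [h', h]), h']

theorem foldl_slide_eq_some_iff (l : List ℕ) {S : BulletFilling r c} {v : ℕ} (h : v ∉ l)
    (b : Box r c) : l.foldl slide S b = some v ↔ S b = some v := by
  induction l generalizing S with
  | nil => rfl
  | cons β l ih =>
    rw [List.mem_cons, not_or] at h
    rw [List.foldl_cons, ih h.2, slide_eq_some_iff_of_ne h.1]

theorem slide_eq_some_self_iff {S : BulletFilling r c} {β : ℕ} (b : Box r c) :
    slide S β b = some β ↔ (S b = some β ∧ ¬ ∃ b', Adjacent b b' ∧ S b' = none) ∨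
      (S b = none ∧ ∃ b', Adjacent b b' ∧ S b' = some β) := by
  classical
  by_cases h : S b = none
  · rw [slide_none h]
    split_ifs with h' <;> simp [h, h']
  · by_cases h2 : S b = some β
    · rw [slide_letter h2]
      split_ifs with h' <;> simp [h2, h']
    · rw [slide_other h h2]
      simp [h, h2]

theorem exists_slide_eq_none {S : BulletFilling r c} (β : ℕ) (h : ∃ b, S b = none) :
    ∃ b, slide S β b = none := by
  classical
  obtain ⟨b, hb⟩ := h
  by_cases h : ∃ b', Adjacent b b' ∧ S b' = some β
  · obtain ⟨b', h1, h2⟩ := h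
    refine ⟨b', ?_⟩
    rw [slide_letter h2, if_pos ⟨b, adjacent_comm.1 h1, hb⟩]
  · refine ⟨b, ?_⟩
    rw [slide_none hb, if_neg h]

theorem exists_foldl_slide_eq_none (l : List ℕ) {S : BulletFilling r c} (h : ∃ b, S b = none) :
    ∃ b, l.foldl slide S b = none := by
  induction l generalizing S with
  | nil => exact h
  | cons β l ih => exact ih (exists_slide_eq_none β h)

theorem delete_eq_some_iff {v : ℕ} (h : v ≠ a) (b : Box r c) :
    delete a T b = some v ↔ T b = v := by
  unfold delete
  split_ifs with h'
  · simp [h', h.symm]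
  · simp

/-- Slides for other letters neither create nor remove copies of `β`, so its final boxes are fixed
by its own slide. -/
theorem gromotion_eq_iff {pre post : List ℕ} {β : ℕ} (hA : (a :: (pre ++ β :: post)).Nodup)
    (b : Box r c) : gromotion (a :: (pre ++ β :: post)) T b = β ↔
      slide (pre.foldl slide (delete a T)) β b = some β := by
  have h1 : β ≠ a := by
    rintro rfl
    simp at hA
  have h2 : β ∉ post := by
    have := (List.nodup_cons.1 hA).2.of_append_right
    exact (List.nodup_cons.1 this).1
  rw [← foldl_slide_eq_some_iff post h2]
  simp only [gromotion, List.foldl_append, List.foldl_cons]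
  cases List.foldl slide (slide (List.foldl slide (delete a T) pre) β) post b with
  | none => simp [h1.symm]
  | some v => simp

theorem state_eq_iff {pre post : List ℕ} {β : ℕ} (hA : (a :: (pre ++ β :: post)).Nodup)
    (b : Box r c) : pre.foldl slide (delete a T) b = some β ↔ T b = β := by
  have h1 : β ≠ a := by
    rintro rfl
    simp at hA
  have h2 : β ∉ pre := by
    have := (List.nodup_cons.1 hA).2
    rw [List.nodup_append] at this
    exact fun h => this.2.2 β h β (by simp) rfl
  rw [foldl_slide_eq_some_iff pre h2, delete_eq_some_iff h1]

/-- A copy of `β` that loses its box passes to every adjacent bullet; `Q` is any region that such a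
passage cannot leave. -/
theorem exists_gromotion_eq {pre post : List ℕ} {β : ℕ} (hA : (a :: (pre ++ β :: post)).Nodup)
    {Q : Box r c → Prop} (hQ : ∀ b b', Q b → Adjacent b b' →
      pre.foldl slide (delete a T) b = some β → pre.foldl slide (delete a T) b' = none → Q b')
    {b : Box r c} (hb : Q b) (hT : T b = β) :
    ∃ b', Q b' ∧ gromotion (a :: (pre ++ β :: post)) T b' = β := by
  have h := (state_eq_iff hA b).2 hT
  simp only [gromotion_eq_iff hA, slide_eq_some_self_iff]
  by_cases h' : ∃ b', Adjacent b b' ∧ pre.foldl slide (delete a T) b' = none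
  · obtain ⟨b', h1, h2⟩ := h'
    exact ⟨b', hQ b b' hb h1 h h2, Or.inr ⟨h2, b, adjacent_comm.1 h1, h⟩⟩
  · exact ⟨b, hb, Or.inl ⟨h, h'⟩⟩

theorem movesUp_of_cross {pre post : List ℕ} {β i : ℕ} {b b' : Box r c} (h : Adjacent b b')
    (hb : i ≤ b.1.val) (hb' : b'.1.val < i) (h1 : pre.foldl slide (delete a T) b = some β)
    (h2 : pre.foldl slide (delete a T) b' = none) : MovesUp (a :: (pre ++ β :: post)) T i β := by
  have h3 : Below b' b := by
    rcases h with h | h | h | h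
    · have := h.1; omega
    · exact h
    · have := congrArg Fin.val h.1; omega
    · have := congrArg Fin.val h.1; omega
  exact ⟨a, pre, post, rfl, b', b, by have := h3.1; omega, h3, h2, h1, b', h, h2⟩

theorem exists_split {β : ℕ} (h : β ∈ a :: R) (hne : β ≠ a) :
    ∃ pre post, R = pre ++ β :: post :=
  List.append_of_mem ((List.mem_cons.1 h).resolve_left hne)

/-- If `β` does not move from row `i + 1` to row `i`, then it stays present below row `i`. -/
theorem exists_below {β i : ℕ} (hA : (a :: R).Nodup) (hβ : β ∈ a :: R) (hne : β ≠ a)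
    (hM : ¬ MovesUp (a :: R) T i β) (h : ∃ b : Box r c, i ≤ b.1.val ∧ T b = β) :
    ∃ b : Box r c, i ≤ b.1.val ∧ gromotion (a :: R) T b = β := by
  obtain ⟨pre, post, rfl⟩ := exists_split hβ hne
  obtain ⟨b, hb, hT⟩ := h
  refine exists_gromotion_eq hA (fun b b' h1 h2 h3 h4 => ?_) hb hT
  by_contra h5
  exact hM (movesUp_of_cross h2 h1 (not_le.1 h5) h3 h4)

/-- If `β` does not move from row `i + 1` to row `i`, and it is present in the first `i` rows
afterwards, then it was there before. -/
theorem exists_above {β i : ℕ} (hA : (a :: R).Nodup) (hβ : β ∈ a :: R) (hne : β ≠ a)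
    (hM : ¬ MovesUp (a :: R) T i β)
    (h : ∃ b : Box r c, b.1.val < i ∧ gromotion (a :: R) T b = β) :
    ∃ b : Box r c, b.1.val < i ∧ T b = β := by
  obtain ⟨pre, post, rfl⟩ := exists_split hβ hne
  obtain ⟨b, hb, h⟩ := h
  rw [gromotion_eq_iff hA, slide_eq_some_self_iff] at h
  rcases h with ⟨h, -⟩ | ⟨h, b', h1, h2⟩
  · exact ⟨b, hb, (state_eq_iff hA b).1 h⟩
  · refine ⟨b', ?_, (state_eq_iff hA b').1 h2⟩
    by_contra h5
    exact hM (movesUp_of_cross (adjacent_comm.1 h1) (not_lt.1 h5) hb h2 h)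

/-- Gromotion does not lose letters. -/
theorem exists_gromotion {β : ℕ} (hA : (a :: R).Nodup) (hT : IncOn (a :: R) T)
    (h : ∃ b, T b = β) : ∃ b, gromotion (a :: R) T b = β := by
  by_cases hne : β = a
  · subst hne
    obtain ⟨b, hb⟩ := h
    obtain ⟨b', hb'⟩ := exists_foldl_slide_eq_none R (S := delete β T) ⟨b, by simp [delete, hb]⟩
    exact ⟨b', by simp [gromotion, hb']⟩
  · obtain ⟨b, hb⟩ := h
    obtain ⟨pre, post, rfl⟩ := exists_split (hb ▸ hT.mem b) hne
    obtain ⟨b', -, h⟩ := exists_gromotion_eq hA (Q := fun _ => True) (fun _ _ _ _ _ _ => trivial)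
      trivial hb
    exact ⟨b', h⟩

/-- The least letter does not occur below the first row. -/
theorem row_eq_zero (hT : IncOn (a :: R) T) {b : Box r c} (hb : T b = a) : b.1.val = 0 := by
  by_contra h
  have := hT.strict (⟨b.1.val - 1, by omega⟩, b.2) b (Or.inr ⟨by simp only; omega, rfl⟩)
  simp [hb] at this

/-- The greatest letter does not occur above the last row. -/
theorem row_eq_last (hA : (R ++ [a]).Nodup) (hT : IncOn (R ++ [a]) T) {b : Box r c}
    (hb : T b = a) : b.1.val + 1 = r := by
  by_contra h
  have h1 := hT.strict b (⟨b.1.val + 1, by omega⟩, b.2) (Or.inr ⟨rfl, rfl⟩)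
  have h2 := List.idxOf_lt_length_of_mem (hT.mem (⟨b.1.val + 1, by omega⟩, b.2))
  have h3 : a ∉ R := by
    rw [List.nodup_append] at hA
    exact fun h => hA.2.2 a h a (by simp) rfl
  simp only [hb, List.idxOf_append, h3, if_false, List.length_append, List.length_singleton] at h1 h2
  simp at h1
  omega

end Movement

/-! ### Where a letter of indegree zero can lie -/

section Digraph

variable {r c q : ℕ}

theorem gromotionIter_head {i : ℕ} (hi : i < q) (T : Filling r c) :
    ∃ R, (gromotionIter i (stdAlphabet q) T).1 = (i + 1) :: R := by
  have hl : (stdAlphabet q).length = q := List.length_range'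
  refine ⟨(stdAlphabet q).drop (i + 1) ++ (stdAlphabet q).take i, ?_⟩
  rw [gromotionIter_fst, List.rotate_eq_drop_append_take (by omega),
    List.drop_eq_getElem_cons (by omega), List.cons_append]
  congr 1
  simp [stdAlphabet]
  omega

theorem gromotionIter_mem {v : ℕ} (hv : v ∈ Set.Icc 1 q) (i : ℕ) (T : Filling r c) :
    v ∈ (gromotionIter i (stdAlphabet q) T).1 := by
  rw [gromotionIter_fst, List.mem_rotate, mem_stdAlphabet]
  exact hv

variable {T : Filling r c} {v i : ℕ}

theorem gromotionIter_exists (hT : IncOn (stdAlphabet q) T) (h : ∃ b, T b = v) (j : ℕ) :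
    ∃ b, (gromotionIter j (stdAlphabet q) T).2 b = v := by
  induction j with
  | zero => exact h
  | succ j ih =>
    have h1 := gromotionIter_nodup j q T
    have h2 := gromotionIter_incOn hT j
    rw [gromotionIter_succ]
    generalize gromotionIter j (stdAlphabet q) T = p at *
    obtain ⟨A, T'⟩ := p
    cases A with
    | nil => exact ih
    | cons a R => exact exists_gromotion h1 h2 ih

theorem gromotionIter_exists_below (hv : v ∈ Set.Icc 1 q)
    (hM : ∀ j < q, ¬ MovesUp (gromotionIter j (stdAlphabet q) T).1
      (gromotionIter j (stdAlphabet q) T).2 i v)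
    (h : ∃ b : Box r c, i ≤ b.1.val ∧ T b = v) {j : ℕ} (hj : j ≤ v - 1) :
    ∃ b : Box r c, i ≤ b.1.val ∧ (gromotionIter j (stdAlphabet q) T).2 b = v := by
  have hv2 := hv.2
  induction j with
  | zero => exact h
  | succ j ih =>
    have h0 := ih (by omega)
    have h1 := gromotionIter_nodup j q T
    have h2 := gromotionIter_mem hv j T
    have h3 := hM j (by omega)
    obtain ⟨R, hR⟩ := gromotionIter_head (q := q) (i := j) (by omega) T
    rw [gromotionIter_succ]
    rw [hR] at h1 h2 h3 ⊢
    exact exists_below h1 h2 (by omega) h3 h0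

theorem gromotionIter_exists_above (hv : v ∈ Set.Icc 1 q)
    (hM : ∀ j < q, ¬ MovesUp (gromotionIter j (stdAlphabet q) T).1
      (gromotionIter j (stdAlphabet q) T).2 i v) (j : ℕ) (hj : v + j ≤ q)
    (h : ∃ b : Box r c, b.1.val < i ∧ (gromotionIter (v + j) (stdAlphabet q) T).2 b = v) :
    ∃ b : Box r c, b.1.val < i ∧ (gromotionIter v (stdAlphabet q) T).2 b = v := by
  induction j with
  | zero => exact h
  | succ j ih =>
    refine ih (by omega) ?_
    have h1 := gromotionIter_nodup (v + j) q T
    have h2 := gromotionIter_mem hv (v + j) T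
    have h3 := hM (v + j) (by omega)
    obtain ⟨R, hR⟩ := gromotionIter_head (q := q) (i := v + j) (by omega) T
    rw [← add_assoc, gromotionIter_succ] at h
    rw [hR] at h1 h2 h3 h
    exact exists_above h1 h2 (by omega) h3 h

/-- If `v` never moves from row `i + 1` to row `i`, then it is only in the first `i` rows of `T`. -/
theorem row_lt_of_not_movesUp (hT : IncOn (stdAlphabet q) T) (hv : v ∈ Set.Icc 1 q) (hi : 1 ≤ i)
    (hM : ∀ j < q, ¬ MovesUp (gromotionIter j (stdAlphabet q) T).1
      (gromotionIter j (stdAlphabet q) T).2 i v) {b : Box r c} (hb : T b = v) : b.1.val < i := by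
  by_contra h
  obtain ⟨b', h1, h2⟩ := gromotionIter_exists_below hv hM ⟨b, not_lt.1 h, hb⟩ le_rfl
  have h3 := gromotionIter_incOn hT (v - 1)
  obtain ⟨hv1, hv2⟩ := hv
  obtain ⟨R, hR⟩ := gromotionIter_head (q := q) (i := v - 1) (by omega) T
  rw [hR] at h3
  have := row_eq_zero h3 (h2.trans (by omega))
  omega

/-- If `v` never moves from row `i + 1` to row `i`, then it is only below the first `i` rows of the
`q`-th iterate. -/
theorem le_row_of_not_movesUp (hT : IncOn (stdAlphabet q) T) (hv : v ∈ Set.Icc 1 q) (hi : i < r)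
    (hM : ∀ j < q, ¬ MovesUp (gromotionIter j (stdAlphabet q) T).1
      (gromotionIter j (stdAlphabet q) T).2 i v) {b : Box r c}
    (hb : (gromotionIter q (stdAlphabet q) T).2 b = v) : i ≤ b.1.val := by
  by_contra h
  have hv2 := hv.2
  obtain ⟨b', h1, h2⟩ := gromotionIter_exists_above hv hM (q - v) (by omega)
    ⟨b, not_le.1 h, by rwa [Nat.add_sub_cancel' hv2]⟩
  have h3 := gromotionIter_incOn hT v
  have h4 := gromotionIter_nodup v q T
  obtain ⟨hv1, hv2⟩ := hv
  obtain ⟨w, rfl⟩ : ∃ w, v = w + 1 := ⟨v - 1, by omega⟩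
  obtain ⟨R, hR⟩ := gromotionIter_head (q := q) (i := w) (by omega) T
  have h5 : (gromotionIter (w + 1) (stdAlphabet q) T).1 = R ++ [w + 1] := by
    rw [gromotionIter_succ, hR, grow_cons]
  rw [h5] at h3 h4
  have := row_eq_last h4 h3 h2
  omega

theorem one_le_indegree_iff {V : Type*} [Finite V] (G : Digraph V) (v : V) :
    1 ≤ indegree G v ↔ ∃ u, G.Adj u v :=
  Set.ncard_pos (Set.toFinite _)

theorem prom_indegree_pos {T : Filling 3 c} (hT : IsPackedIncreasing q T) (hi1 : 1 ≤ i)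
    (hi3 : i < 3) (v : Set.Icc 1 q) : 1 ≤ indegree (prom q T i) v := by
  rw [one_le_indegree_iff]
  by_contra hcon
  have hM : ∀ j < q, ¬ MovesUp (gromotionIter j (stdAlphabet q) T).1
      (gromotionIter j (stdAlphabet q) T).2 i v := by
    intro j hj h
    exact hcon ⟨⟨j + 1, by simp; omega⟩, h⟩
  have hI := hT.toIsIncreasing.incOn
  obtain ⟨b, hb⟩ := hT.packed v v.2
  have h1 := row_lt_of_not_movesUp hI v.2 hi1 hM hb
  obtain rfl | rfl : i = 1 ∨ i = 2 := by omega
  -- For `i = 1`, `v` lies in the first row of `T`, which is restored, although `v` must have left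
  -- it.
  · have h2 := gromotionIter_frame hT.toIsIncreasing b (Or.inl (by omega))
    have h3 := le_row_of_not_movesUp hI v.2 hi3 hM (h2.trans hb)
    omega
  -- For `i = 2`, `v` survives in the last row of the `q`-th iterate, which is the last row of `T`,
  -- where `v` cannot be.
  · obtain ⟨b', hb'⟩ := gromotionIter_exists hI ⟨b, hb⟩ q
    have h3 := le_row_of_not_movesUp hI v.2 hi3 hM hb'
    have h2 := gromotionIter_frame hT.toIsIncreasing b' (Or.inr (by omega))
    have h4 := row_lt_of_not_movesUp hI v.2 hi1 hM (h2.symm.trans hb')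
    omega

end Digraph

/-! ### A tableau with four rows -/

section FourRows

/-- Continue with the value of a numeral. -/
def withNat {α : Type} (n : ℕ) (F : ℕ → α) : α :=
  -- The case split forces the numeral to be evaluated before `F` receives it, so kernel
  -- computations do not pile up unevaluated terms.
  match n with
  | 0 => F 0
  | k + 1 => F (k + 1)

theorem withNat_eq {α : Type} (n : ℕ) (F : ℕ → α) : withNat n F = F n := by
  cases n <;> rfl

/-- A `4 × 4` filling written as a numeral in base 16, where the digit `0` stands for `•`. -/
def decode (n : ℕ) : BulletFilling 4 4 := fun b =>
  withNat (n / 16 ^ (4 * b.1.val + b.2.val) % 16) fun d => if d = 0 then none else some d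

/-- The numeral of a filling. -/
def encode (S : BulletFilling 4 4) : ℕ :=
  ([0, 1, 2, 3] : List (Fin 4)).foldr (fun x m =>
    ([0, 1, 2, 3] : List (Fin 4)).foldr (fun y m => m * 16 + (S (x, y)).getD 0) m) 0

/-- The numeral of a filling, if it has one. -/
def reify (S : BulletFilling 4 4) : Option ℕ :=
  -- The round trip is checked box by box, so `encode` needs no correctness proof.
  withNat (encode S) fun n => if ∀ x y, decode n (x, y) = S (x, y) then some n else none

theorem decode_of_reify {S : BulletFilling 4 4} {n : ℕ} (h : reify S = some n) : decode n = S := by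
  unfold reify at h
  rw [withNat_eq] at h
  split_ifs at h with h'
  cases h
  exact funext fun b => h' b.1 b.2

/-- No `v` is below a `•` in row `i`. -/
def NoMove (i v n : ℕ) : Prop :=
  ∀ x x' y : Fin 4, x.val + 1 = i → x'.val = i → decode n (x, y) = none → decode n (x', y) ≠ some v

instance (i v n : ℕ) : Decidable (NoMove i v n) := by unfold NoMove; infer_instance

/-- Slide the letters of a list, and give up if `v` moves from row `i + 1` to row `i`. -/
def slides (i v : ℕ) : List ℕ → ℕ → Option ℕ
  | [], n => some n
  | β :: R, n =>
    if β = v ∧ ¬ NoMove i v n then none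
    else match reify (slide (decode n) β) with
      | none => none
      | some m => slides i v R m

/-- Soundness of the computed slides: every intermediate filling is certified by its numeral,
including the one just before the slide of `v`. -/
theorem slides_spec {i v : ℕ} {R : List ℕ} : ∀ {n m : ℕ}, slides i v R n = some m →
    R.foldl slide (decode n) = decode m ∧ ∀ pre post, R = pre ++ v :: post →
      ∃ k, pre.foldl slide (decode n) = decode k ∧ NoMove i v k := by
  induction R with
  | nil =>
    intro n m h
    cases h
    exact ⟨rfl, fun pre post h => by simp at h⟩
  | cons β R ih =>
    intro n m h
    simp only [slides] at h
    split_ifs at h with h1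
    cases h2 : reify (slide (decode n) β) with
    | none => simp [h2] at h
    | some k =>
      simp only [h2] at h
      obtain ⟨h3, h4⟩ := ih h
      rw [decode_of_reify h2] at h3 h4
      refine ⟨h3, fun pre post h5 => ?_⟩
      cases pre with
      | nil =>
        simp only [List.nil_append, List.cons.injEq] at h5
        exact ⟨n, rfl, by_contra fun h6 => h1 ⟨h5.1, h6⟩⟩
      | cons β' pre =>
        simp only [List.cons_append, List.cons.injEq] at h5
        obtain ⟨rfl, h5⟩ := h5
        exact h4 pre post h5

/-- The filling without `•` of a numeral. -/
def decodeFilling (n : ℕ) : Filling 4 4 := fun b => (decode n b).getD 0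

/-- `m` applications of gromotion, given up if `v` moves from row `i + 1` to row `i`. -/
def iterates (i v : ℕ) : ℕ → List ℕ → ℕ → Bool
  | 0, _, _ => true
  | _ + 1, [], _ => false
  | m + 1, a :: R, n =>
    match reify (delete a (decodeFilling n)) with
    | none => false
    | some k =>
      match slides i v R k with
      | none => false
      | some k' =>
        match reify fun b => some ((decode k' b).getD a) with
        | none => false
        | some n' => iterates i v m (R ++ [a]) n'

theorem iterates_spec {i v m : ℕ} : ∀ {A : List ℕ} {n : ℕ}, A.Nodup → iterates i v m A n = true →
    ∀ j < m, ¬ MovesUp (gromotionIter j A (decodeFilling n)).1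
      (gromotionIter j A (decodeFilling n)).2 i v := by
  induction m with
  | zero => intro A n _ _ j hj; omega
  | succ m ih =>
    intro A n hA h j hj
    cases A with
    | nil => simp [iterates] at h
    | cons a R =>
      simp only [iterates] at h
      cases h1 : reify (delete a (decodeFilling n)) with
      | none => simp [h1] at h
      | some k =>
        simp only [h1] at h
        cases h2 : slides i v R k with
        | none => simp [h2] at h
        | some k' =>
          simp only [h2] at h
          cases h3 : reify fun b => some ((decode k' b).getD a) with
          | none => simp [h3] at h
          | some n' =>
            simp only [h3] at h
            obtain ⟨h4, h5⟩ := slides_spec h2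
            rw [decode_of_reify h1] at h4 h5
            cases j with
            | zero =>
              rintro ⟨a', pre, post, h6, b, b', h7, h8, h9, h10⟩
              replace h6 : a :: R = a' :: (pre ++ v :: post) := h6
              rw [List.cons.injEq] at h6
              obtain ⟨rfl, h6⟩ := h6
              obtain ⟨l, h11, h12⟩ := h5 pre post h6
              have h13 : pre.foldl slide (delete a (decodeFilling n)) b = none := h9
              have h14 : pre.foldl slide (delete a (decodeFilling n)) b' = some v := h10.1
              rw [h11] at h13 h14
              have h15 : b' = (b'.1, b.2) := Prod.ext rfl h8.2
              rw [h15] at h14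
              exact h12 b.1 b'.1 b.2 h7 (by have := h8.1; omega) h13 h14
            | succ j =>
              have h6 : decodeFilling n' = gromotion (a :: R) (decodeFilling n) := by
                funext b
                simp only [decodeFilling, decode_of_reify h3, gromotion]
                rw [← h4]
                rfl
              have h7 := ih (A := R ++ [a]) (n := n')
                (by rw [← grow_cons, grow, List.nodup_rotate]; exact hA) h j (by omega)
              rw [h6, ← grow_cons] at h7
              exact h7

/-- The tableau with the rows `1 2 4 6`, `2 3 5 8`, `4 6 7 9` and `6 9 10 11`. -/
def fourRows : Filling 4 4 := decodeFilling 0xba96976485326421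

theorem fourRows_isPackedIncreasing : IsPackedIncreasing 11 fourRows where
  mem_alphabet := by
    have : ∀ x y, 1 ≤ fourRows (x, y) ∧ fourRows (x, y) ≤ 11 := by decide +kernel
    exact fun b => this b.1 b.2
  row_strictMono := by
    have : ∀ x y y', y < y' → fourRows (x, y) < fourRows (x, y') := by decide +kernel
    exact fun x y y' h => this x y y' h
  col_strictMono := by
    have : ∀ y x x', x < x' → fourRows (x, y) < fourRows (x', y) := by decide +kernel
    exact fun y x x' h => this y x x' h
  packed := by
    have : ∀ v < 12, 1 ≤ v → ∃ x y, fourRows (x, y) = v := by decide +kernel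
    intro v hv
    obtain ⟨x, y, h⟩ := this v (by have := hv.2; omega) hv.1
    exact ⟨(x, y), h⟩

/-- The letter 5 occurs only in row 2 of this tableau; never crossing from row 3 to row 2, it must
end up in row 3, which the restoration of the outer rows does not forbid. -/
theorem fourRows_iterates : iterates 2 5 11 (stdAlphabet 11) 0xba96976485326421 = true := by
  decide +kernel

theorem fourRows_indegree : indegree (prom 11 fourRows 2) ⟨5, by simp⟩ = 0 := by
  unfold indegree
  rw [Set.ncard_eq_zero (Set.toFinite _), Set.eq_empty_iff_forall_notMem]
  intro u hu
  have hu2 := u.2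
  exact iterates_spec (stdAlphabet_nodup 11) fourRows_iterates (u.val - 1)
    (by have := hu2.1; have := hu2.2; omega) hu

end FourRows

end KPromotion

theorem mainTheorem8 :
    (∀ (c q : ℕ) (T : KPromotion.Filling 3 c), KPromotion.IsPackedIncreasing q T →
      ∀ i : ℕ, 1 ≤ i → i < 3 → ∀ v : Set.Icc 1 q,
        1 ≤ KPromotion.indegree (KPromotion.prom q T i) v) ∧
    (∃ (c q : ℕ) (T : KPromotion.Filling 4 c), KPromotion.IsPackedIncreasing q T ∧
      ∃ i : ℕ, 1 ≤ i ∧ i < 4 ∧ ∃ v : Set.Icc 1 q,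
        KPromotion.indegree (KPromotion.prom q T i) v = 0) :=
  ⟨fun _ _ _ hT _ h1 h3 v => KPromotion.prom_indegree_pos hT h1 h3 v,
    4, 11, KPromotion.fourRows, KPromotion.fourRows_isPackedIncreasing, 2, by norm_num, by norm_num,
    ⟨5, by simp⟩, KPromotion.fourRows_indegree⟩
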